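/- Notation. A Boolean function on $N$ variables is a map $\{-1,1\}^N\to\{-1,1\}$, and $\mathrm{Corr}(f,g)=\bigl|\mathbb{E}_{x}[f(x)g(x)]\bigr|$ for $x$ uniform on $\{-1,1\}^N$. A threshold formula is a rooted tree whose leaves are labelled by variables and whose internal nodes are threshold gates, i.e. gates computing $y\mapsto\mathrm{sgn}(\langle w,y\rangle-\theta)$ with $w\in\mathbb{R}^m$, $\theta\in\mathbb{R}$, where $\mathrm{sgn}(t)=1$ if $t>0$ and $-1$ otherwise; fan-in and depth are arbitrary, and the number of wires is the sum of the fan-ins of all gates. A map $E:\{-1,1\}^n\to\{-1,1\}^m$ is an $(n,k,m,\zeta)$ bit-fixing extractor if for every $X$ uniform on a subcube of $\{-1,1\}^n$ of dimension at least $k$, $E(X)$ has statistical distance at most $\zeta$ from uniform on $\{-1,1\}^m$. An injective map $\mathrm{Enc}:\{-1,1\}^a\to\{-1,1\}^b$ is an $(\alpha,L)$ error-correcting code if every Hamming ball of relative radius $\alpha$ contains at most $L$ codewords. Generalized Andreev function. Let $0<\gamma\le 1$, $c_0>0$, $A>0$ be constants and $m=\lfloor 0.9\,n^{\gamma}\rfloor$.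 Let $E$ be any $(n,\,n^\gamma,\,m,\,2^{-n^{c_0\gamma}})$ bit-fixing extractor and $\mathrm{Enc}:\{-1,1\}^{4n}\to\{-1,1\}^{2^m}$ any $(\tfrac12-A\,2^{-m/4},\,2^{m/2})$ error-correcting code. Reading the output of $E$ as a number in $\{0,\dots,2^m-1\}$, the Generalized Andreev function with parameter $\gamma$ is $F:\{-1,1\}^{4n}\times\{-1,1\}^{n}\to\{-1,1\}$, $F(x_1,x_2)=\mathrm{Enc}(x_1)_{E(x_2)}$. Theorem. For every $c_0>0$ there is a constant $c>0$ such that for all $\gamma\in(0,1]$ and $A>0$ there is an $n_0$ such that for all $n\ge n_0$, every Generalized Andreev function $F$ as above (with any choice of $E$ and $\mathrm{Enc}$), and every threshold formula $D$ on $5n$ variables, of any depth and arity, with at most $n^{2-3\gamma}$ wires, $$\mathrm{Corr}(D,F)\le\exp\bigl(-n^{c\gamma}\bigr).$$ -/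

import Mathlib

noncomputable section

namespace ThresholdAndreev

/-- The Boolean cube `{-1,1}^ι`; the group of units of `ℤ` is exactly `{-1, 1}`. -/
abbrev Cube (ι : Type) : Type := ι → ℤˣ

/-- `Corr(f,g) = |E_x[f(x) g(x)]|` for `x` uniform on the cube. -/
def corr {ι : Type} [Fintype ι] [DecidableEq ι] (f g : Cube ι → ℤˣ) : ℝ :=
  |(∑ x : Cube ι, ((f x : ℤ) : ℝ) * ((g x : ℤ) : ℝ)) / (Fintype.card (Cube ι) : ℝ)|

/-- The sign of a real number, with the convention `sgn 0 = -1`. -/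
def sgn (t : ℝ) : ℤˣ := if 0 < t then 1 else -1

/-- Threshold formulas over the variables `ι`: trees whose leaves are labelled by variables and
whose internal nodes are threshold gates `(w, θ)` of arbitrary (finite) fan-in `m`. -/
inductive ThresholdFormula (ι : Type) : Type where
  | var (i : ι) : ThresholdFormula ι
  | gate (m : ℕ) (w : Fin m → ℝ) (θ : ℝ) (child : Fin m → ThresholdFormula ι) :
      ThresholdFormula ι

/-- The Boolean function computed by a threshold formula. A gate `(w, θ)` outputs
`sgn(⟨w, y⟩ - θ)`, where `y` is the vector of values of its children. -/
def ThresholdFormula.eval {ι : Type} : ThresholdFormula ι → Cube ι → ℤˣ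
  | .var i, x => x i
  | .gate _ w θ child, x => sgn (∑ j, w j * ((((child j).eval x : ℤˣ) : ℤ) : ℝ) - θ)

/-- The wire complexity: the sum of the fan-ins of all gates. -/
def ThresholdFormula.wires {ι : Type} : ThresholdFormula ι → ℕ
  | .var _ => 0
  | .gate m _ _ child => m + ∑ j, (child j).wires

/-- The subcube of `{-1,1}^n` whose free coordinates are those in `S`, all other coordinates being
fixed as in `b`. Its dimension is the cardinality of `S`. -/
def subcube {n : ℕ} (S : Finset (Fin n)) (b : Cube (Fin n)) : Finset (Cube (Fin n)) :=
  {x | ∀ i, i ∉ S → x i = b i}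

/-- `E` is an `(n, k, m, ζ)` bit-fixing extractor: for `X` uniform on a subcube of dimension at
least `k`, the statistical (total variation) distance of `E(X)` from uniform is at most `ζ`. -/
def IsBitFixingExtractor {n m : ℕ} (E : Cube (Fin n) → Cube (Fin m)) (k ζ : ℝ) : Prop :=
  ∀ (S : Finset (Fin n)) (b : Cube (Fin n)), k ≤ (S.card : ℝ) →
    (1 / 2 : ℝ) * ∑ y : Cube (Fin m),
      |((({x ∈ subcube S b | E x = y} : Finset (Cube (Fin n))).card : ℝ) /
          ((subcube S b).card : ℝ)) - 1 / (2 : ℝ) ^ m| ≤ ζ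

/-- `Enc : {-1,1}^a → {-1,1}^b` defines an `(α, L)` error-correcting code: distinct messages have
distinct codewords, and every Hamming ball of relative radius `α` contains at most `L`
codewords. -/
def IsErrorCorrectingCode {a b : ℕ} (Enc : Cube (Fin a) → Cube (Fin b)) (α L : ℝ) : Prop :=
  Function.Injective Enc ∧
    ∀ z : Cube (Fin b),
      (({c ∈ Finset.univ.image Enc | (hammingDist c z : ℝ) / (b : ℝ) ≤ α} :
        Finset (Cube (Fin b))).card : ℝ) ≤ L

/-- A string in `{-1,1}^m` read as a binary number in `{0, …, 2^m - 1}` (the symbol `1` stands for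
the bit `0` and `-1` for the bit `1`). -/
def toIndex {m : ℕ} (y : Cube (Fin m)) : Fin (2 ^ m) :=
  finFunctionFinEquiv fun i => if y i = 1 then (0 : Fin 2) else 1

/-- The output length `m = 0.9 n^γ` of the extractor, rounded down. -/
def outLen (γ : ℝ) (n : ℕ) : ℕ := ⌊(0.9 : ℝ) * (n : ℝ) ^ γ⌋₊

/-- The Generalized Andreev function `F(x₁, x₂) = Enc(x₁)_{E(x₂)}` on the `4n + n = 5n` variables
indexed by `Fin (4 * n) ⊕ Fin n`: the left summand carries `x₁` and the right one `x₂`. -/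
def andreev {n m : ℕ} (E : Cube (Fin n) → Cube (Fin m))
    (Enc : Cube (Fin (4 * n)) → Cube (Fin (2 ^ m))) :
    Cube (Fin (4 * n) ⊕ Fin n) → ℤˣ :=
  fun x => Enc (fun i => x (Sum.inl i)) (toIndex (E fun i => x (Sum.inr i)))

end ThresholdAndreev

end

open ThresholdAndreev

namespace ThresholdAndreev

open Finset

/-! Put K = n^γ. Some set S of ⌈K⌉ variables of x₂ carries at most its proportional share of the
leaves (`exists_light_subset`); fix every variable outside S. The weights belong to the formula, so
at each gate the inputs without live leaves only shift the threshold, and a given weighted sum on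
2^|S| points admits at most 2^|S| + 1 threshold patterns. Hence all restrictions of D lie in one
family of size 2^O(|S| · live leaves), whatever the fixed values, x₁ included
(`ThresholdFormula.exists_restrictions`). The wire bound keeps this size at most 2 · 2^(5n/2).

Conversely, E is nearly uniform on each subcube with free set S, so list decoding lets any one test
correlate with at most L/τ messages x₁ (`card_mul_le_of_correlated`). A union bound over the family
leaves an exponentially small fraction of the 2^(4n) messages correlated with D; averaging over
subcubes gives `corr_andreev_le`. -/

/-! ### Threshold patterns and leaf counts -/

/-- The functions `x ↦ sgn (g x - θ)`, as `θ` ranges over the reals. -/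
theorem exists_thresholds_of_function {X : Type} [Fintype X] [DecidableEq X] (g : X → ℝ) :
    ∃ P : Finset (X → ℤˣ), (∀ θ : ℝ, (fun x => sgn (g x - θ)) ∈ P) ∧
      P.card ≤ Fintype.card X + 1 := by
  classical
  let P : Finset (X → ℤˣ) := univ.filter fun f => ∃ θ : ℝ, f = fun x => sgn (g x - θ)
  refine ⟨P, fun θ => by simpa [P] using ⟨θ, rfl⟩, ?_⟩
  -- As θ varies the sets where the value is 1 form a chain, so their sizes tell the functions
  -- apart.
  let F : (X → ℤˣ) → ℕ := fun f => (univ.filter fun x => f x = 1).card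
  have hsgn (t : ℝ) : sgn t = 1 ↔ 0 < t := by
    unfold sgn
    split_ifs with h
    · simp [h]
    · simp [h]
  have key : ∀ θ θ' : ℝ, θ ≤ θ' →
      F (fun x => sgn (g x - θ)) = F (fun x => sgn (g x - θ')) →
      (fun x => sgn (g x - θ)) = fun x => sgn (g x - θ') := by
    intro θ θ' hle hF
    have hsub : (univ.filter fun x => sgn (g x - θ') = 1) ⊆
        univ.filter fun x => sgn (g x - θ) = 1 := by
      intro x
      simp only [mem_filter, mem_univ, true_and, hsgn]
      intro h
      linarith
    have heq := eq_of_subset_of_card_le hsub hF.le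
    funext x
    have hx : sgn (g x - θ') = 1 ↔ sgn (g x - θ) = 1 := by
      simpa using Finset.ext_iff.mp heq x
    rcases Int.units_eq_one_or (sgn (g x - θ)) with h | h
    · rw [h, hx.mpr h]
    · rcases Int.units_eq_one_or (sgn (g x - θ')) with h' | h'
      · rw [hx.mp h', h']
      · rw [h, h']
  have hinj : Set.InjOn F P := by
    intro f hf f' hf' h
    obtain ⟨θ, rfl⟩ : ∃ θ : ℝ, f = fun x => sgn (g x - θ) := by simpa [P] using hf
    obtain ⟨θ', rfl⟩ : ∃ θ : ℝ, f' = fun x => sgn (g x - θ) := by simpa [P] using hf'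
    rcases le_total θ θ' with hle | hle
    · exact key θ θ' hle h
    · exact (key θ' θ hle h.symm).symm
  have hmaps : Set.MapsTo F P (range (Fintype.card X + 1)) := by
    intro f _
    simp only [coe_range, Set.mem_Iio, Nat.lt_succ_iff, F]
    exact card_le_univ _
  simpa using card_le_card_of_injOn F hmaps hinj

/-- The number of leaves of a threshold formula that are labelled by a given variable. -/
def ThresholdFormula.leafCount {ι : Type} [DecidableEq ι] : ThresholdFormula ι → ι → ℕ
  | .var j, i => if i = j then 1 else 0
  | .gate _ _ _ child, i => ∑ j, (child j).leafCount i

/-- The wire into each child pays for that child's `+ 1`; the last `+ 1` covers a bare leaf. -/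
theorem ThresholdFormula.sum_leafCount_le {ι : Type} [DecidableEq ι] (T : Finset ι)
    (D : ThresholdFormula ι) : ∑ i ∈ T, D.leafCount i ≤ D.wires + 1 := by
  induction D with
  | var j =>
    simp only [leafCount, wires, sum_ite_eq']
    split_ifs <;> simp
  | gate m w θ child ih =>
    simp only [leafCount, wires]
    rw [sum_comm]
    calc ∑ j, ∑ i ∈ T, (child j).leafCount i ≤ ∑ j, ((child j).wires + 1) :=
          sum_le_sum fun j _ => ih j
      _ ≤ _ := by rw [sum_add_distrib]; simp; omega

/-! ### Counting restrictions of a formula -/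

section restrictions

variable {ι A X : Type} [DecidableEq ι] {T : Finset ι} {μ : A → X → Cube ι}

theorem ThresholdFormula.eval_eq_of_leafCount_eq_zero
    (hfix : ∀ a u v i, i ∉ T → μ a u i = μ a v i) (D : ThresholdFormula ι)
    (h : ∑ i ∈ T, D.leafCount i = 0) (a : A) (u v : X) :
    D.eval (μ a u) = D.eval (μ a v) := by
  induction D with
  | var j =>
    refine hfix a u v j fun hj => ?_
    have := sum_eq_zero_iff.mp h j hj
    simp [leafCount] at this
  | gate m w θ child ih =>
    have h0 : ∀ j, ∑ i ∈ T, (child j).leafCount i = 0 := by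
      simp only [leafCount] at h
      rw [sum_comm] at h
      exact fun j => sum_eq_zero_iff.mp h j (mem_univ j)
    simp only [eval]
    congr 2
    exact sum_congr rfl fun j _ => by rw [ih j (h0 j)]

/-- A gate with a single non-constant input computes that input, its negation or a constant. -/
theorem sgn_unary_mem {G : Finset (X → ℤˣ)} (hneg : ∀ f ∈ G, -f ∈ G) (hone : (1 : X → ℤˣ) ∈ G)
    {f : X → ℤˣ} (hf : f ∈ G) (w θ : ℝ) :
    (fun u => sgn (w * ((f u : ℤ) : ℝ) - θ)) ∈ G := by
  have hval : ∀ u, sgn (w * ((f u : ℤ) : ℝ) - θ) =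
      if f u = 1 then sgn (w - θ) else sgn (-w - θ) := by
    intro u
    rcases Int.units_eq_one_or (f u) with h | h <;> simp [h]
  simp only [hval]
  have heq {F F' : X → ℤˣ} (hF : F ∈ G) (h : ∀ u, F' u = F u) : F' ∈ G := by
    rwa [funext h]
  rcases Int.units_eq_one_or (sgn (w - θ)) with h | h <;>
    rcases Int.units_eq_one_or (sgn (-w - θ)) with h' | h' <;> simp only [h, h']
  · exact heq hone (by simp)
  · exact heq hf fun u => by rcases Int.units_eq_one_or (f u) with h | h <;> simp [h]
  · exact heq (hneg f hf) fun u => by rcases Int.units_eq_one_or (f u) with h | h <;> simp [h]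
  · exact heq (hneg 1 hone) (by simp)

variable [Fintype X] [DecidableEq X] [Nonempty X]

/-- The restrictions of a threshold formula, with `T` the set of live variables and the other
variables fixed arbitrarily, lie in a small family of functions. -/
theorem ThresholdFormula.exists_restrictions_of_pos
    (hfix : ∀ a u v i, i ∉ T → μ a u i = μ a v i)
    (hfree : ∀ a b u i, i ∈ T → μ a u i = μ b u i)
    {M : ℕ} (hM : 2 * Fintype.card X + 4 ≤ M)
    (D : ThresholdFormula ι) (hpos : 0 < ∑ i ∈ T, D.leafCount i) :
    ∃ G : Finset (X → ℤˣ), (∀ a, (fun u => D.eval (μ a u)) ∈ G) ∧ (∀ f ∈ G, -f ∈ G) ∧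
      1 ∈ G ∧ M * G.card ≤ M ^ (2 * ∑ i ∈ T, D.leafCount i) := by
  classical
  -- The spare factor `M` on the left drives the induction. A gate with one live child costs
  -- nothing, because the family is closed under negation and contains the constants. With at least
  -- two live children, the product of their bounds supplies `M ^ 2`: one factor pays for the new
  -- threshold, negations and constants, the other restores the invariant.
  induction D with
  | var j =>
    have hj : j ∈ T := by
      by_contra hj
      simp [leafCount, hj] at hpos
    rcases isEmpty_or_nonempty A with hA | ⟨⟨a₀⟩⟩
    · refine ⟨{1, -1}, fun a => (hA.false a).elim, ?_, by simp, ?_⟩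
      · intro f hf
        simp only [mem_insert, mem_singleton] at hf ⊢
        rcases hf with rfl | rfl <;> simp
      · have : ∑ i ∈ T, (var j).leafCount i = 1 := by simp [leafCount, hj]
        rw [this, mul_one, pow_two]
        exact Nat.mul_le_mul_left _ (card_le_two.trans (by omega))
    · let f₀ : X → ℤˣ := fun u => μ a₀ u j
      refine ⟨{f₀, -f₀, 1, -1}, fun a => ?_, ?_, by simp, ?_⟩
      · have : (fun u => (var j).eval (μ a u)) = f₀ := funext fun u => hfree a a₀ u j hj
        simp [this]
      · intro f hf
        simp only [mem_insert, mem_singleton] at hf ⊢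
        rcases hf with rfl | rfl | rfl | rfl <;> simp
      · have : ∑ i ∈ T, (var j).leafCount i = 1 := by simp [leafCount, hj]
        rw [this, mul_one, pow_two]
        exact Nat.mul_le_mul_left _ (card_le_four.trans (by omega))
  | gate m w θ child ih =>
    have hM0 : 0 < M := by omega
    have hsum : ∑ i ∈ T, (gate m w θ child).leafCount i =
        ∑ j, ∑ i ∈ T, (child j).leafCount i := by
      simp only [leafCount]
      rw [sum_comm]
    let J : Finset (Fin m) := univ.filter fun j => 0 < ∑ i ∈ T, (child j).leafCount i
    have hJmem : ∀ j, j ∈ J ↔ 0 < ∑ i ∈ T, (child j).leafCount i := by simp [J]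
    have hsumJ : ∑ i ∈ T, (gate m w θ child).leafCount i =
        ∑ j ∈ J, ∑ i ∈ T, (child j).leafCount i := by
      rw [hsum]
      symm
      refine sum_subset (subset_univ J) fun j _ hj => ?_
      have := (hJmem j).not.mp hj
      omega
    have hconst : ∀ a, ∃ θ' : ℝ, ∀ u, (gate m w θ child).eval (μ a u) =
        sgn (∑ j ∈ J, w j * (((child j).eval (μ a u) : ℤ) : ℝ) - θ') := by
      intro a
      obtain ⟨u₀⟩ := ‹Nonempty X›
      refine ⟨θ - ∑ j ∈ univ \ J, w j * (((child j).eval (μ a u₀) : ℤ) : ℝ), fun u => ?_⟩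
      simp only [eval]
      congr 1
      rw [← sum_sdiff (subset_univ J)]
      have : ∑ j ∈ univ \ J, w j * (((child j).eval (μ a u) : ℤ) : ℝ) =
          ∑ j ∈ univ \ J, w j * (((child j).eval (μ a u₀) : ℤ) : ℝ) := by
        refine sum_congr rfl fun j hj => ?_
        have hj' := (hJmem j).not.mp (mem_sdiff.mp hj).2
        rw [eval_eq_of_leafCount_eq_zero hfix (child j) (by omega) a u u₀]
      rw [this]
      ring
    choose! G hG hGneg hGone hGcard using ih
    have hJne : J.Nonempty := by
      by_contra hJ
      rw [not_nonempty_iff_eq_empty] at hJ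
      rw [hsumJ, hJ] at hpos
      simp at hpos
    rcases hJne.exists_eq_singleton_or_nontrivial with ⟨j₀, hj₀⟩ | hnt
    · have hpos₀ : 0 < ∑ i ∈ T, (child j₀).leafCount i := (hJmem j₀).mp (by simp [hj₀])
      refine ⟨G j₀, fun a => ?_, hGneg j₀ hpos₀, hGone j₀ hpos₀, ?_⟩
      · obtain ⟨θ', hθ'⟩ := hconst a
        simp only [hθ', hj₀, sum_singleton]
        exact sgn_unary_mem (hGneg j₀ hpos₀) (hGone j₀ hpos₀) (hG j₀ hpos₀ a) (w j₀) θ'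
      · rw [hsumJ, hj₀, sum_singleton]
        exact hGcard j₀ hpos₀
    · choose P hP hPcard using fun g : X → ℝ => exists_thresholds_of_function g
      -- Children without live leaves get the dummy value 1, so only live ones enter the count.
      let H : Finset (Fin m → X → ℤˣ) := Fintype.piFinset fun j => if j ∈ J then G j else {1}
      let Q : Finset (X → ℤˣ) :=
        H.biUnion fun f => P fun u => ∑ j ∈ J, w j * ((f j u : ℤ) : ℝ)
      have hHcard : H.card = ∏ j ∈ J, (G j).card := by
        rw [Fintype.card_piFinset, ← prod_subset (subset_univ J)]
        · exact prod_congr rfl fun j hj => by simp [hj]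
        · intro j _ hj
          simp [hj]
      have hHpos : 0 < H.card := by
        rw [hHcard]
        exact prod_pos fun j hj => card_pos.mpr ⟨1, hGone j ((hJmem j).mp hj)⟩
      have hQcard : Q.card ≤ H.card * (Fintype.card X + 1) :=
        card_biUnion_le_card_mul _ _ _ fun f _ => hPcard _
      refine ⟨(Q ∪ Q.image (fun f => -f)) ∪ {1, -1}, fun a => ?_, ?_, by simp, ?_⟩
      · obtain ⟨θ', hθ'⟩ := hconst a
        simp only [hθ']
        refine mem_union_left _ (mem_union_left _ (mem_biUnion.mpr
          ⟨fun j u => if j ∈ J then (child j).eval (μ a u) else 1, ?_, ?_⟩))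
        · refine Fintype.mem_piFinset.mpr fun j => ?_
          by_cases hj : j ∈ J
          · simpa [hj] using hG j ((hJmem j).mp hj) a
          · simp only [hj, if_false, mem_singleton]
            rfl
        · convert hP _ θ' using 3 with u
          congr 1
          exact sum_congr rfl fun j hj => by simp [hj]
      · intro f hf
        simp only [mem_union, mem_image, mem_insert, mem_singleton] at hf ⊢
        rcases hf with (hf | ⟨f', hf', rfl⟩) | (rfl | rfl)
        · exact Or.inl (Or.inr ⟨f, hf, rfl⟩)
        · exact Or.inl (Or.inl (by simpa using hf'))
        · simp
        · simp
      · have hcard : ((Q ∪ Q.image (fun f => -f)) ∪ {1, -1}).card ≤ M * H.card := by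
          calc ((Q ∪ Q.image (fun f => -f)) ∪ {1, -1}).card
              ≤ (Q.card + Q.card) + 2 :=
                (card_union_le _ _).trans (add_le_add ((card_union_le _ _).trans
                  (add_le_add le_rfl card_image_le)) card_le_two)
            _ ≤ (2 * Fintype.card X + 4) * H.card := by nlinarith
            _ ≤ M * H.card := Nat.mul_le_mul_right _ hM
        have hprod : M ^ J.card * H.card ≤ M ^ (2 * ∑ i ∈ T, (gate m w θ child).leafCount i) := by
          rw [hHcard, ← prod_const, ← prod_mul_distrib, hsumJ, mul_sum, ← prod_pow_eq_pow_sum]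
          exact prod_le_prod' fun j hj => hGcard j ((hJmem j).mp hj)
        calc M * ((Q ∪ Q.image (fun f => -f)) ∪ {1, -1}).card ≤ M * (M * H.card) :=
              Nat.mul_le_mul_left _ hcard
          _ = M ^ 2 * H.card := by ring
          _ ≤ M ^ J.card * H.card :=
              Nat.mul_le_mul_right _ (Nat.pow_le_pow_right hM0 (one_lt_card_iff_nontrivial.mpr hnt))
          _ ≤ _ := hprod

/-- Without live leaves the invariant `M * G.card ≤ M ^ 0` is impossible; the two constants then
suffice, whence the factor 2. -/
theorem ThresholdFormula.exists_restrictions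
    (hfix : ∀ a u v i, i ∉ T → μ a u i = μ a v i)
    (hfree : ∀ a b u i, i ∈ T → μ a u i = μ b u i)
    {M : ℕ} (hM : 2 * Fintype.card X + 4 ≤ M) (D : ThresholdFormula ι) :
    ∃ G : Finset (X → ℤˣ), (∀ a, (fun u => D.eval (μ a u)) ∈ G) ∧ (∀ f ∈ G, -f ∈ G) ∧
      G.card ≤ 2 * M ^ (2 * ∑ i ∈ T, D.leafCount i) := by
  rcases Nat.eq_zero_or_pos (∑ i ∈ T, D.leafCount i) with h0 | hpos
  · refine ⟨{1, -1}, fun a => ?_, ?_, ?_⟩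
    · obtain ⟨u₀⟩ := ‹Nonempty X›
      have h : (fun u => D.eval (μ a u)) = fun _ => D.eval (μ a u₀) :=
        funext fun u => eval_eq_of_leafCount_eq_zero hfix D h0 a u u₀
      rw [h]
      simp only [mem_insert, mem_singleton]
      rcases Int.units_eq_one_or (D.eval (μ a u₀)) with h | h <;> rw [h]
      · exact Or.inl rfl
      · exact Or.inr rfl
    · intro f hf
      simp only [mem_insert, mem_singleton] at hf ⊢
      rcases hf with rfl | rfl <;> simp
    · rw [h0]
      exact card_le_two
  · obtain ⟨G, hG, hneg, -, hcard⟩ := exists_restrictions_of_pos hfix hfree hM D hpos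
    refine ⟨G, hG, hneg, ?_⟩
    calc G.card ≤ M * G.card := Nat.le_mul_of_pos_left _ (by omega)
      _ ≤ _ := hcard.trans (Nat.le_mul_of_pos_left _ two_pos)

end restrictions

/-! ### Choosing the live variables -/

/-- Some `k` of the elements carry at most their proportional share of the total weight. -/
theorem exists_light_subset {α : Type} [Fintype α] [DecidableEq α] (f : α → ℕ) {k : ℕ}
    (hk : k ≤ Fintype.card α) :
    ∃ S : Finset α, S.card = k ∧ Fintype.card α * ∑ i ∈ S, f i ≤ k * ∑ i, f i := by
  -- Discarding a heaviest element never raises the average weight.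
  induction hk using Nat.decreasingInduction with
  | self => exact ⟨univ, card_univ, le_rfl⟩
  | of_succ k hk ih =>
    obtain ⟨S, hS, hle⟩ := ih
    obtain ⟨x, hx, hmax⟩ := exists_max_image S f (card_pos.mp (by omega))
    refine ⟨S.erase x, by simp [card_erase_of_mem hx, hS], ?_⟩
    have h1 : ∑ i ∈ S, f i ≤ (k + 1) * f x := by
      simpa [hS] using sum_le_card_nsmul S f (f x) hmax
    have h2 : ∑ i ∈ S.erase x, f i + f x = ∑ i ∈ S, f i := sum_erase_add S f hx
    have h3 : (k + 1) * ∑ i ∈ S.erase x, f i ≤ k * ∑ i ∈ S, f i := by nlinarith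
    refine Nat.le_of_mul_le_mul_left (c := k + 1) ?_ k.succ_pos
    calc (k + 1) * (Fintype.card α * ∑ i ∈ S.erase x, f i)
        = Fintype.card α * ((k + 1) * ∑ i ∈ S.erase x, f i) := by ring
      _ ≤ Fintype.card α * (k * ∑ i ∈ S, f i) := Nat.mul_le_mul_left _ h3
      _ = k * (Fintype.card α * ∑ i ∈ S, f i) := by ring
      _ ≤ k * ((k + 1) * ∑ i, f i) := Nat.mul_le_mul_left _ hle
      _ = (k + 1) * (k * ∑ i, f i) := by ring

/-! ### List decoding against a near-uniform index -/

theorem toIndex_bijective (m : ℕ) : Function.Bijective (toIndex (m := m)) := by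
  rw [Fintype.bijective_iff_injective_and_card]
  refine ⟨fun y y' h => ?_, by simp [Fintype.card_units_int]⟩
  have h' := finFunctionFinEquiv.injective h
  funext i
  have hi := congrFun h' i
  rcases Int.units_eq_one_or (y i) with h1 | h1 <;>
    rcases Int.units_eq_one_or (y' i) with h2 | h2 <;> simp [h1, h2] at hi ⊢

theorem sum_mul_eq_card_sub_hammingDist {N : ℕ} (c z : Cube (Fin N)) :
    ∑ i, ((c i : ℤ) : ℝ) * ((z i : ℤ) : ℝ) = N - 2 * (hammingDist c z : ℝ) := by
  have h : ∀ i, ((c i : ℤ) : ℝ) * ((z i : ℤ) : ℝ) = 1 - 2 * (if c i ≠ z i then 1 else 0) := by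
    intro i
    rcases Int.units_eq_one_or (c i) with h1 | h1 <;>
      rcases Int.units_eq_one_or (z i) with h2 | h2 <;> simp [h1, h2] <;> norm_num
  rw [sum_congr rfl fun i _ => h i, sum_sub_distrib, ← mul_sum]
  have h' : ∑ i, (if c i ≠ z i then (1 : ℝ) else 0) = hammingDist c z := by
    rw [sum_boole]
    rfl
  rw [h']
  simp

theorem abs_units_cast (u : ℤˣ) : |((u : ℤ) : ℝ)| = 1 := by
  rcases Int.units_eq_one_or u with h | h <;> simp [h]

/-- A code has few codewords correlated with a given test composed with a near-uniform map. -/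
theorem card_mul_le_of_correlated {a m : ℕ} {Enc : Cube (Fin a) → Cube (Fin (2 ^ m))} {τ L : ℝ}
    (hEnc : IsErrorCorrectingCode Enc (1 / 2 - τ / 2) L) (hτ : 0 ≤ τ)
    {α : Type} {Q : Finset α} (hQ : Q.Nonempty) (E : α → Cube (Fin m)) {ζ : ℝ}
    (hE : (1 / 2 : ℝ) * ∑ y : Cube (Fin m),
      |((({x ∈ Q | E x = y} : Finset α).card : ℝ) / (Q.card : ℝ)) - 1 / (2 : ℝ) ^ m| ≤ ζ)
    (g : α → ℤˣ) {ε : ℝ} (B : Finset (Cube (Fin a)))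
    (hB : ∀ c ∈ B, ε * Q.card ≤
      ∑ x ∈ Q, ((g x : ℤ) : ℝ) * ((Enc c (toIndex (E x)) : ℤ) : ℝ)) :
    B.card * (ε - 2 * ζ - τ) ≤ L := by
  classical
  have hQ0 : (0 : ℝ) < Q.card := by exact_mod_cast card_pos.mpr hQ
  have hN0 : (0 : ℝ) < 2 ^ m := by positivity
  -- `z` is the majority vote of the codewords of `B`, so ∑ |C i| is their total agreement with one
  -- word. This bounds the test `g` even though `g` need not factor through `E`.
  let C : Fin (2 ^ m) → ℝ := fun i => ∑ c ∈ B, ((Enc c i : ℤ) : ℝ)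
  let z : Cube (Fin (2 ^ m)) := fun i => if 0 ≤ C i then 1 else -1
  have hC : ∀ i, |C i| ≤ B.card := fun i =>
    (abs_sum_le_sum_abs _ _).trans (by simp [abs_units_cast])
  have hz : ∀ i, ((z i : ℤ) : ℝ) * C i = |C i| := by
    intro i
    by_cases h : 0 ≤ C i
    · simp [z, h, abs_of_nonneg h]
    · simp [z, h, abs_of_neg (not_le.mp h)]
  have hball : ((B.filter fun c => (hammingDist (Enc c) z : ℝ) / ((2 ^ m : ℕ) : ℝ) ≤
      1 / 2 - τ / 2).card : ℝ) ≤ L := by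
    refine le_trans ?_ (hEnc.2 z)
    rw [← card_image_of_injective _ hEnc.1]
    refine Nat.cast_le.mpr (card_le_card fun y hy => ?_)
    simp only [mem_image, mem_filter, mem_univ, true_and] at hy ⊢
    obtain ⟨c, ⟨-, hc⟩, rfl⟩ := hy
    exact ⟨⟨c, rfl⟩, hc⟩
  have hupper : ∑ i, |C i| ≤ 2 ^ m * (L + B.card * τ) := by
    calc ∑ i, |C i| = ∑ c ∈ B, ∑ i, ((Enc c i : ℤ) : ℝ) * ((z i : ℤ) : ℝ) := by
          rw [sum_comm]
          refine sum_congr rfl fun i _ => ?_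
          rw [← hz i, ← sum_mul, mul_comm]
      -- Outside the ball the normalized correlation with `z` is below 1 - 2(1/2 - τ/2) = τ; inside
      -- it is at most 1.
      _ ≤ ∑ c ∈ B, 2 ^ m * ((if (hammingDist (Enc c) z : ℝ) / ((2 ^ m : ℕ) : ℝ) ≤ 1 / 2 - τ / 2
            then 1 else 0) + τ) := by
          refine sum_le_sum fun c _ => ?_
          rw [sum_mul_eq_card_sub_hammingDist]
          push_cast
          split_ifs with h
          · have : (0 : ℝ) ≤ hammingDist (Enc c) z := Nat.cast_nonneg _
            nlinarith
          · rw [not_le, lt_div_iff₀ hN0] at h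
            nlinarith
      _ = 2 ^ m * ((B.filter fun c => (hammingDist (Enc c) z : ℝ) / ((2 ^ m : ℕ) : ℝ) ≤
            1 / 2 - τ / 2).card + B.card * τ) := by
          rw [← mul_sum, sum_add_distrib]
          simp
      _ ≤ _ := by gcongr
  have hlower : B.card * (ε * Q.card) ≤
      ∑ y : Cube (Fin m), (({x ∈ Q | E x = y} : Finset α).card : ℝ) * |C (toIndex y)| := by
    calc B.card * (ε * Q.card) = ∑ _c ∈ B, ε * Q.card := by simp
      _ ≤ ∑ c ∈ B, ∑ x ∈ Q, ((g x : ℤ) : ℝ) * ((Enc c (toIndex (E x)) : ℤ) : ℝ) := sum_le_sum hB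
      _ = ∑ x ∈ Q, ((g x : ℤ) : ℝ) * C (toIndex (E x)) := by
          rw [sum_comm]
          exact sum_congr rfl fun x _ => by rw [mul_sum]
      _ ≤ ∑ x ∈ Q, |C (toIndex (E x))| := by
          refine sum_le_sum fun x _ => (le_abs_self _).trans ?_
          rw [abs_mul, abs_units_cast, one_mul]
      _ = _ := by
          rw [← sum_fiberwise Q E]
          refine sum_congr rfl fun y _ => ?_
          rw [sum_congr rfl (g := fun _ => |C (toIndex y)|)
            fun x hx => by rw [(mem_filter.mp hx).2]]
          simp
  have hindex : ∑ y : Cube (Fin m), |C (toIndex y)| = ∑ i, |C i| :=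
    Function.Bijective.sum_comp (toIndex_bijective m) fun i => |C i|
  -- Replacing the law of `E` by the uniform one costs its ℓ¹ distance, at most `2 * ζ`, times the
  -- bound `B.card` on |C|.
  have hmid : B.card * ε ≤ 1 / 2 ^ m * ∑ i, |C i| + 2 * ζ * B.card := by
    rw [← mul_assoc, ← le_div_iff₀ hQ0, sum_div] at hlower
    refine hlower.trans ?_
    rw [← hindex, mul_sum]
    calc _ ≤ ∑ y : Cube (Fin m), (1 / 2 ^ m * |C (toIndex y)| +
          |((({x ∈ Q | E x = y} : Finset α).card : ℝ) / (Q.card : ℝ)) - 1 / (2 : ℝ) ^ m| *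
            B.card) := by
          refine sum_le_sum fun y _ => ?_
          have h1 := le_abs_self
            (((({x ∈ Q | E x = y} : Finset α).card : ℝ) / (Q.card : ℝ)) - 1 / (2 : ℝ) ^ m)
          have h2 := mul_le_mul h1 le_rfl (abs_nonneg (C (toIndex y))) (abs_nonneg _)
          have h3 := mul_le_mul_of_nonneg_left (hC (toIndex y)) (abs_nonneg
            (((({x ∈ Q | E x = y} : Finset α).card : ℝ) / (Q.card : ℝ)) - 1 / (2 : ℝ) ^ m))
          rw [mul_div_right_comm]
          linarith
      _ ≤ _ := by
          rw [sum_add_distrib, ← sum_mul]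
          gcongr
          linarith
  have : 1 / 2 ^ m * ∑ i, |C i| ≤ L + B.card * τ := by
    rw [one_div, inv_mul_le_iff₀ hN0]
    exact hupper
  linarith

/-! ### Averaging over subcubes -/

theorem card_subcube {n : ℕ} (S : Finset (Fin n)) (b : Cube (Fin n)) :
    (subcube S b).card = 2 ^ S.card := by
  have h : subcube S b = Fintype.piFinset fun i => if i ∈ S then (univ : Finset ℤˣ) else {b i} := by
    ext x
    simp only [subcube, mem_filter, mem_univ, true_and, Fintype.mem_piFinset]
    refine forall_congr' fun i => ?_
    by_cases hi : i ∈ S <;> simp [hi, Int.units_eq_one_or]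
  rw [h, Fintype.card_piFinset, ← prod_subset (subset_univ S)]
  · rw [prod_congr rfl (g := fun _ => 2) fun i hi => by simp [hi], prod_const]
  · intro i _ hi
    simp [hi]

/-- Each point lies in the subcubes of exactly the 2^|S| base points that agree with it off `S`. -/
theorem sum_sum_subcube {n : ℕ} (S : Finset (Fin n)) (f : Cube (Fin n) → ℝ) :
    ∑ b, ∑ x ∈ subcube S b, f x = 2 ^ S.card * ∑ x, f x := by
  rw [sum_comm' (t' := univ) (s' := fun x => subcube S x), mul_sum]
  · refine sum_congr rfl fun x _ => ?_
    simp [card_subcube]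
  · intro b x
    simp only [subcube, mem_filter, mem_univ, true_and, and_true]
    exact forall₂_congr fun i _ => eq_comm

/-- The correlation of a threshold formula with the Andreev function, in terms of the number of
leaves of the formula in a set `S` of variables of the extractor. -/
theorem corr_andreev_le {n m : ℕ} {E : Cube (Fin n) → Cube (Fin m)}
    {Enc : Cube (Fin (4 * n)) → Cube (Fin (2 ^ m))} {k ζ τ L : ℝ}
    (hE : IsBitFixingExtractor E k ζ) (hτ : 0 < τ)
    (hEnc : IsErrorCorrectingCode Enc (1 / 2 - τ / 2) L)
    (D : ThresholdFormula (Fin (4 * n) ⊕ Fin n)) (S : Finset (Fin n)) (hS : k ≤ S.card)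
    {M : ℕ} (hM : 2 * 2 ^ S.card + 4 ≤ M) :
    corr D.eval (andreev E Enc) ≤ 2 * τ + 2 * ζ +
      ((2 * M ^ (2 * ∑ i ∈ S, D.leafCount (Sum.inr i)) : ℕ) : ℝ) * (L / τ) / 2 ^ (4 * n) := by
  classical
  let T : Finset (Fin (4 * n) ⊕ Fin n) := S.map Function.Embedding.inr
  let μ : Cube (Fin (4 * n)) × Cube (Fin n) → Cube S → Cube (Fin (4 * n) ⊕ Fin n) :=
    fun a u => Sum.elim a.1 fun i => if h : i ∈ S then u ⟨i, h⟩ else a.2 i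
  have hfix : ∀ a u v i, i ∉ T → μ a u i = μ a v i := by
    rintro a u v (i | i) hi
    · rfl
    · have hi' : i ∉ S := by simpa [T] using hi
      simp [μ, hi']
  have hfree : ∀ a b u i, i ∈ T → μ a u i = μ b u i := by
    rintro a b u (i | i) hi
    · simp [T] at hi
    · have hi' : i ∈ S := by simpa [T] using hi
      simp [μ, hi']
  have hX : Fintype.card (Cube S) = 2 ^ S.card := by simp [Fintype.card_units_int]
  obtain ⟨G, hG, hneg, hcard⟩ := D.exists_restrictions hfix hfree (M := M) (by rw [hX]; exact hM)
  have hsumT : ∑ i ∈ T, D.leafCount i = ∑ i ∈ S, D.leafCount (Sum.inr i) := by simp [T]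
  rw [hsumT] at hcard
  -- Chosen so that `ε - 2 * ζ - τ = τ`, which yields the list bound `L / τ`.
  let ε : ℝ := 2 * τ + 2 * ζ
  let V : Cube (Fin (4 * n)) → Cube (Fin n) → ℝ := fun c x =>
    ((D.eval (Sum.elim c x) : ℤ) : ℝ) * ((Enc c (toIndex (E x)) : ℤ) : ℝ)
  have hVabs : ∀ c x, |V c x| = 1 := fun c x => by simp [V, abs_mul, abs_units_cast]
  let proj : Cube (Fin n) → Cube S := fun x i => x i
  have hproj : ∀ c b, ∀ x ∈ subcube S b, Sum.elim c x = μ (c, b) (proj x) := by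
    intro c b x hx
    have hx' : ∀ i, i ∉ S → x i = b i := by simpa [subcube] using hx
    funext i
    rcases i with i | i
    · rfl
    · by_cases hi : i ∈ S
      · simp [μ, proj, hi]
      · simp [μ, hi, hx' i hi]
  have hL : 0 ≤ L := (Nat.cast_nonneg _).trans (hEnc.2 1)
  have hsubne : ∀ b, (subcube S b).Nonempty := fun b => ⟨b, by simp [subcube]⟩
  let bad : Cube (Fin n) → Finset (Cube (Fin (4 * n))) := fun b =>
    univ.filter fun c => ε * (subcube S b).card < |∑ x ∈ subcube S b, V c x|
  have hbad : ∀ b, ((bad b).card : ℝ) ≤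
      ((2 * M ^ (2 * ∑ i ∈ S, D.leafCount (Sum.inr i)) : ℕ) : ℝ) * (L / τ) := by
    intro b
    let B : (Cube S → ℤˣ) → Finset (Cube (Fin (4 * n))) := fun g => univ.filter fun c =>
      ε * (subcube S b).card ≤
        ∑ x ∈ subcube S b, ((g (proj x) : ℤ) : ℝ) * ((Enc c (toIndex (E x)) : ℤ) : ℝ)
    have hB : ∀ g, ((B g).card : ℝ) ≤ L / τ := by
      intro g
      rw [le_div_iff₀ hτ]
      have := card_mul_le_of_correlated hEnc hτ.le (hsubne b) E (hE S b hS) (fun x => g (proj x))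
        (ε := ε) (B g) fun c hc => (mem_filter.mp hc).2
      have hε : ε - 2 * ζ - τ = τ := by simp only [ε]; ring
      rwa [hε] at this
    have hsub : bad b ⊆ G.biUnion B := by
      intro c hc
      have hc' := (mem_filter.mp hc).2
      have hV : ∑ x ∈ subcube S b, V c x = ∑ x ∈ subcube S b,
          ((D.eval (μ (c, b) (proj x)) : ℤ) : ℝ) * ((Enc c (toIndex (E x)) : ℤ) : ℝ) :=
        sum_congr rfl fun x hx => by simp only [V]; rw [hproj c b x hx]
      rw [mem_biUnion]
      rcases lt_abs.mp hc' with h | h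
      · refine ⟨_, hG (c, b), mem_filter.mpr ⟨mem_univ _, ?_⟩⟩
        rw [← hV]
        exact h.le
      -- Closure of `G` under negation handles negative correlation.
      · refine ⟨_, hneg _ (hG (c, b)), mem_filter.mpr ⟨mem_univ _, ?_⟩⟩
        refine h.le.trans_eq ?_
        rw [hV, ← sum_neg_distrib]
        exact sum_congr rfl fun x _ => by simp
    calc ((bad b).card : ℝ) ≤ ((G.biUnion B).card : ℝ) := by exact_mod_cast card_le_card hsub
      _ ≤ ∑ g ∈ G, ((B g).card : ℝ) := by exact_mod_cast card_biUnion_le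
      _ ≤ G.card * (L / τ) := by
          rw [← nsmul_eq_mul]
          exact sum_le_card_nsmul _ _ _ fun g _ => hB g
      _ ≤ _ := by
          have : (G.card : ℝ) ≤ _ := Nat.cast_le.mpr hcard
          exact mul_le_mul_of_nonneg_right this (by positivity)
  have hε0 : 0 ≤ ε := by
    have hζ : 0 ≤ ζ := le_trans (by positivity) (hE S 1 hS)
    positivity
  have hinner : ∀ b, ∑ c, |∑ x ∈ subcube S b, V c x| ≤ 2 ^ S.card * (2 ^ (4 * n) * ε +
      ((2 * M ^ (2 * ∑ i ∈ S, D.leafCount (Sum.inr i)) : ℕ) : ℝ) * (L / τ)) := by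
    intro b
    calc ∑ c, |∑ x ∈ subcube S b, V c x|
        ≤ ∑ c, 2 ^ S.card * (ε + if c ∈ bad b then 1 else 0) := by
          refine sum_le_sum fun c _ => ?_
          have hQ : ((subcube S b).card : ℝ) = 2 ^ S.card := by rw [card_subcube]; simp
          by_cases hc : c ∈ bad b
          · rw [if_pos hc]
            refine (abs_sum_le_sum_abs _ _).trans ?_
            simp only [hVabs, sum_const, nsmul_eq_mul, hQ]
            gcongr
            linarith
          · rw [if_neg hc]
            have : |∑ x ∈ subcube S b, V c x| ≤ ε * (subcube S b).card := by
              simpa [bad] using hc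
            rw [hQ] at this
            linarith
      _ = 2 ^ S.card * (2 ^ (4 * n) * ε + (bad b).card) := by
          rw [← mul_sum, sum_add_distrib]
          simp [Fintype.card_units_int]
      _ ≤ _ := by
          gcongr
          exact hbad b
  have htotal : ∑ x, ((D.eval x : ℤ) : ℝ) * ((andreev E Enc x : ℤ) : ℝ) = ∑ c, ∑ x, V c x := by
    rw [← Fintype.sum_prod_type']
    refine Fintype.sum_equiv (Equiv.sumArrowEquivProdArrow _ _ _) _ _ fun x => ?_
    have : Sum.elim (fun i => x (Sum.inl i)) (fun i => x (Sum.inr i)) = x := by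
      funext i
      rcases i with i | i <;> rfl
    simp only [V, Equiv.sumArrowEquivProdArrow, Equiv.coe_fn_mk]
    congr 4
    exact this.symm
  have hsum : 2 ^ S.card * |∑ c, ∑ x, V c x| ≤ 2 ^ S.card * (2 ^ n * (2 ^ (4 * n) * ε +
      ((2 * M ^ (2 * ∑ i ∈ S, D.leafCount (Sum.inr i)) : ℕ) : ℝ) * (L / τ))) := by
    calc 2 ^ S.card * |∑ c, ∑ x, V c x| = |∑ b, ∑ c, ∑ x ∈ subcube S b, V c x| := by
          rw [sum_comm (s := univ (α := Cube (Fin n))),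
            sum_congr rfl fun c _ => sum_sum_subcube S (V c), ← mul_sum, abs_mul, abs_of_pos
            (by positivity : (0 : ℝ) < 2 ^ S.card)]
      _ ≤ ∑ b, ∑ c, |∑ x ∈ subcube S b, V c x| :=
          (abs_sum_le_sum_abs _ _).trans (sum_le_sum fun b _ => abs_sum_le_sum_abs _ _)
      _ ≤ ∑ _b : Cube (Fin n), 2 ^ S.card * (2 ^ (4 * n) * ε +
            ((2 * M ^ (2 * ∑ i ∈ S, D.leafCount (Sum.inr i)) : ℕ) : ℝ) * (L / τ)) :=
          sum_le_sum fun b _ => hinner b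
      _ = _ := by
          simp only [sum_const, nsmul_eq_mul, card_univ, Fintype.card_pi, Fintype.card_units_int,
            prod_const, Fintype.card_fin]
          push_cast
          ring
  have hsum' := le_of_mul_le_mul_left hsum (by positivity)
  have hcardX : (Fintype.card (Cube (Fin (4 * n) ⊕ Fin n)) : ℝ) = 2 ^ (4 * n) * 2 ^ n := by
    rw [← pow_add]
    simp [Fintype.card_units_int]
  unfold corr
  rw [htotal, hcardX, abs_div, abs_of_pos (by positivity : (0 : ℝ) < 2 ^ (4 * n) * 2 ^ n),
    div_le_iff₀ (by positivity)]
  refine hsum'.trans_eq ?_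
  simp only [ε]
  field_simp

/-! ### Numerical estimates -/

/-- Since d > c, the exponent eventually beats 2x^c; one copy of exp(-x^c) absorbs 3|C|. The 1/3
leaves room for three error terms. -/
theorem eventually_mul_two_rpow_le_exp (C : ℝ) {a c d : ℝ} (ha : 0 < a) (hc : 0 < c)
    (hcd : c < d) :
    ∀ᶠ x : ℝ in Filter.atTop, C * (2 : ℝ) ^ (-(a * x ^ d)) ≤ Real.exp (-(x ^ c)) / 3 := by
  have hb : 0 < a * Real.log 2 / 2 := by have := Real.log_pos one_lt_two; positivity
  have h1 : Filter.Tendsto (fun x : ℝ => x ^ (d - c)) Filter.atTop Filter.atTop :=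
    tendsto_rpow_atTop (by linarith)
  have h2 : Filter.Tendsto (fun x : ℝ => x ^ c) Filter.atTop Filter.atTop :=
    tendsto_rpow_atTop hc
  have h3 := Real.tendsto_exp_atTop.comp h2
  filter_upwards [h1.eventually_ge_atTop (2 / (a * Real.log 2)),
    h3.eventually_ge_atTop (3 * |C|), Filter.eventually_gt_atTop 0] with x hx1 hx2 hx
  have hl := Real.log_pos one_lt_two
  have hal : 0 < a * Real.log 2 := by positivity
  rw [div_le_iff₀ hal] at hx1
  have hxd : x ^ d = x ^ (d - c) * x ^ c := by rw [← Real.rpow_add hx]; ring_nf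
  have hxc : 0 < x ^ c := Real.rpow_pos_of_pos hx c
  have hexp : (2 : ℝ) ^ (-(a * x ^ d)) ≤ Real.exp (-(x ^ c)) * Real.exp (-(x ^ c)) := by
    rw [Real.rpow_def_of_pos two_pos, ← Real.exp_add, Real.exp_le_exp, hxd]
    nlinarith
  have hprod : Real.exp (x ^ c) * Real.exp (-(x ^ c)) = 1 := by rw [← Real.exp_add]; simp
  have he := Real.exp_pos (-(x ^ c))
  simp only [Function.comp] at hx2
  calc C * (2 : ℝ) ^ (-(a * x ^ d)) ≤ |C| * (Real.exp (-(x ^ c)) * Real.exp (-(x ^ c))) :=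
        mul_le_mul (le_abs_self C) hexp (by positivity) (abs_nonneg C)
    _ ≤ Real.exp (-(x ^ c)) / 3 := by nlinarith

/-- Here k = ⌈K⌉, `s` counts wires and `l` live leaves; the left side is the exponent of the family
size for M = 2^(k+3). It must stay well below the message length 4n. -/
theorem live_leaves_bound {K n s k l : ℝ} (hK : 40 ≤ K) (hKn : K ≤ n) (hs : s ≤ n ^ 2 / K ^ 3)
    (hs0 : 0 ≤ s) (hk0 : 0 ≤ k) (hk : k ≤ K + 1) (hl : n * l ≤ k * (s + 1)) :
    2 * (k + 3) * l ≤ 5 / 2 * n := by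
  have hn : 0 < n := by linarith
  have hK0 : 0 < K := by linarith
  have h1 : (k + 3) * k ≤ 6 / 5 * K ^ 2 := by nlinarith
  have h2 : K ^ 2 * (s + 1) ≤ 41 / 40 * n ^ 2 := by
    have h3 : K ^ 2 * s ≤ n ^ 2 / K := by
      calc K ^ 2 * s ≤ K ^ 2 * (n ^ 2 / K ^ 3) := by gcongr
        _ = n ^ 2 / K := by field_simp
    have h4 : n ^ 2 / K ≤ n ^ 2 / 40 := by gcongr
    nlinarith
  have h5 : n * (2 * (k + 3) * l) ≤ n * (5 / 2 * n) := by
    calc n * (2 * (k + 3) * l) = 2 * (k + 3) * (n * l) := by ring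
      _ ≤ 2 * (k + 3) * (k * (s + 1)) := by gcongr
      _ = 2 * ((k + 3) * k) * (s + 1) := by ring
      _ ≤ 2 * (6 / 5 * K ^ 2) * (s + 1) := by gcongr
      _ = 12 / 5 * (K ^ 2 * (s + 1)) := by ring
      _ ≤ 12 / 5 * (41 / 40 * n ^ 2) := by gcongr
      _ ≤ n * (5 / 2 * n) := by nlinarith
  exact le_of_mul_le_mul_left h5 hn

/-- With `μ` the extractor's output length, the exponent is at most (5/2 + (3/4) · 0.9 - 4)n =
-0.825n. -/
theorem two_pow_mul_div_le {A μ n : ℝ} (hA : 0 < A) (hμ : μ ≤ 0.9 * n) (k l N : ℕ) (hN : (N : ℝ) = n)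
    (hl : 2 * ((k : ℝ) + 3) * l ≤ 5 / 2 * n) :
    ((2 * (2 ^ (k + 3)) ^ (2 * l) : ℕ) : ℝ) *
      ((2 : ℝ) ^ (μ / 2) / (2 * (A * (2 : ℝ) ^ (-(μ / 4))))) / 2 ^ (4 * N) ≤
      1 / A * (2 : ℝ) ^ (-(4 / 5 * n)) := by
  have h2 : (0 : ℝ) < 2 := two_pos
  have hpow : ((2 * (2 ^ (k + 3)) ^ (2 * l) : ℕ) : ℝ) =
      2 * (2 : ℝ) ^ (2 * ((k : ℝ) + 3) * l) := by
    rw [← pow_mul]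
    push_cast
    rw [← Real.rpow_natCast]
    congr 2
    push_cast
    ring
  have hden : (2 : ℝ) ^ (4 * N) = (2 : ℝ) ^ (4 * n) := by
    rw [← Real.rpow_natCast, ← hN]
    push_cast
    rfl
  rw [hpow, hden]
  have heq : 2 * (2 : ℝ) ^ (2 * ((k : ℝ) + 3) * l) *
      ((2 : ℝ) ^ (μ / 2) / (2 * (A * (2 : ℝ) ^ (-(μ / 4))))) / (2 : ℝ) ^ (4 * n) =
      1 / A * (2 : ℝ) ^ (2 * ((k : ℝ) + 3) * l + μ / 2 + μ / 4 - 4 * n) := by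
    rw [Real.rpow_sub h2, Real.rpow_add h2, Real.rpow_add h2, Real.rpow_neg h2.le]
    field_simp
  rw [heq]
  gcongr
  · norm_num
  · by_cases hn : 0 ≤ n
    · linarith
    · exact (hn (hN ▸ Nat.cast_nonneg N)).elim

end ThresholdAndreev

/-! ### The main theorem -/

open ThresholdAndreev
theorem mainTheorem10 :
    ∀ c₀ : ℝ, 0 < c₀ → ∃ c : ℝ, 0 < c ∧
      ∀ γ : ℝ, 0 < γ → γ ≤ 1 → ∀ A : ℝ, 0 < A →
        ∃ n₀ : ℕ, ∀ n : ℕ, n₀ ≤ n →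
          ∀ (E : Cube (Fin n) → Cube (Fin (outLen γ n)))
            (Enc : Cube (Fin (4 * n)) → Cube (Fin (2 ^ outLen γ n))),
            IsBitFixingExtractor E ((n : ℝ) ^ γ) ((2 : ℝ) ^ (-((n : ℝ) ^ (c₀ * γ)))) →
            IsErrorCorrectingCode Enc
              (1 / 2 - A * (2 : ℝ) ^ (-((outLen γ n : ℝ) / 4)))
              ((2 : ℝ) ^ ((outLen γ n : ℝ) / 2)) →
            ∀ D : ThresholdFormula (Fin (4 * n) ⊕ Fin n),
              (D.wires : ℝ) ≤ (n : ℝ) ^ (2 - 3 * γ) →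
              corr D.eval (andreev E Enc) ≤ Real.exp (-((n : ℝ) ^ (c * γ))) := by
  intro c₀ hc₀
  have hmin : 0 < min c₀ 1 := lt_min hc₀ one_pos
  -- The exponent must lie strictly below both c₀ (extractor error 2^(-K^c₀)) and 1 (the errors
  -- 2^(-Ω(K))).
  refine ⟨min c₀ 1 / 2, by positivity, fun γ hγ hγ1 A hA => ?_⟩
  have hc0 : 0 < min c₀ 1 / 2 := by positivity
  have hcc₀ : min c₀ 1 / 2 < c₀ := by linarith [min_le_left c₀ 1]
  have hc1 : min c₀ 1 / 2 < 1 := by linarith [min_le_right c₀ 1]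
  have hlim : Filter.Tendsto (fun n : ℕ => (n : ℝ) ^ γ) Filter.atTop Filter.atTop :=
    (tendsto_rpow_atTop hγ).comp tendsto_natCast_atTop_atTop
  obtain ⟨n₀, hn₀⟩ := Filter.eventually_atTop.mp (hlim.eventually
    -- 9/40 is 0.9/4, and 2^(1/4) compensates for the floor in `outLen`.
    ((eventually_mul_two_rpow_le_exp (4 * A * (2 : ℝ) ^ (1 / 4 : ℝ)) (a := 9 / 40) (by norm_num)
      hc0 hc1).and ((eventually_mul_two_rpow_le_exp 2 one_pos hc0 hcc₀).and
    ((eventually_mul_two_rpow_le_exp (1 / A) (a := 4 / 5) (by norm_num) hc0 hc1).and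
      (Filter.eventually_ge_atTop 40)))))
  refine ⟨n₀, fun n hn E Enc hE hEnc D hD => ?_⟩
  obtain ⟨hτ, hζ, hbad, hK⟩ := hn₀ n hn
  have hn1 : 1 ≤ (n : ℝ) := by
    rcases Nat.eq_zero_or_pos n with rfl | h
    · rw [Nat.cast_zero, Real.zero_rpow hγ.ne'] at hK
      norm_num at hK
    · exact_mod_cast h
  have hnn : (0 : ℝ) ≤ n := by linarith
  have hKn : (n : ℝ) ^ γ ≤ n := by simpa using Real.rpow_le_rpow_of_exponent_le hn1 hγ1
  have hwires : (n : ℝ) ^ (2 - 3 * γ) = (n : ℝ) ^ 2 / ((n : ℝ) ^ γ) ^ 3 := by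
    rw [Real.rpow_sub (by linarith), mul_comm, Real.rpow_mul hnn]
    norm_cast
  have hc₀γ : (n : ℝ) ^ (c₀ * γ) = ((n : ℝ) ^ γ) ^ c₀ := by rw [mul_comm, Real.rpow_mul hnn]
  have hcγ : (n : ℝ) ^ (min c₀ 1 / 2 * γ) = ((n : ℝ) ^ γ) ^ (min c₀ 1 / 2) := by
    rw [mul_comm, Real.rpow_mul hnn]
  have hm1 : (outLen γ n : ℝ) ≤ 0.9 * (n : ℝ) ^ γ := Nat.floor_le (by positivity)
  have hm2 : 0.9 * (n : ℝ) ^ γ < outLen γ n + 1 := Nat.lt_floor_add_one _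
  rw [hcγ]
  rw [hwires] at hD
  rw [hc₀γ] at hE
  generalize (n : ℝ) ^ γ = K at *
  have hceil : ⌈K⌉₊ ≤ Fintype.card (Fin n) := by
    rw [Fintype.card_fin]
    exact Nat.ceil_le.mpr hKn
  obtain ⟨S, hScard, hSle⟩ := exists_light_subset (fun i => D.leafCount (Sum.inr i)) hceil
  have hleaves : ∑ i, D.leafCount (Sum.inr i) ≤ D.wires + 1 := by
    simpa using D.sum_leafCount_le (Finset.univ.map Function.Embedding.inr)
  have hSle' : (n : ℝ) * ((∑ i ∈ S, D.leafCount (Sum.inr i) : ℕ) : ℝ) ≤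
      (⌈K⌉₊ : ℝ) * ((D.wires : ℝ) + 1) := by
    have := hSle.trans (Nat.mul_le_mul_left _ hleaves)
    rw [Fintype.card_fin] at this
    exact_mod_cast this
  have hbits := live_leaves_bound hK hKn hD (Nat.cast_nonneg _) (Nat.cast_nonneg _)
    (Nat.ceil_lt_add_one (by linarith)).le hSle'
  have hEnc' : IsErrorCorrectingCode Enc
      (1 / 2 - 2 * (A * (2 : ℝ) ^ (-((outLen γ n : ℝ) / 4))) / 2)
      ((2 : ℝ) ^ ((outLen γ n : ℝ) / 2)) := by
    rwa [mul_div_cancel_left₀ _ (two_ne_zero' ℝ)]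
  have hmain := corr_andreev_le hE (by positivity) hEnc' D S
    (by rw [hScard]; exact Nat.le_ceil K) (M := 2 ^ (⌈K⌉₊ + 3))
    (by rw [hScard, pow_add]; have := Nat.one_le_two_pow (n := ⌈K⌉₊); omega)
  have herr := two_pow_mul_div_le hA (hm1.trans (by gcongr)) ⌈K⌉₊ _ n rfl hbits
  have htau : 2 * (2 * (A * (2 : ℝ) ^ (-((outLen γ n : ℝ) / 4)))) ≤
      4 * A * (2 : ℝ) ^ (1 / 4 : ℝ) * (2 : ℝ) ^ (-(9 / 40 * K ^ (1 : ℝ))) := by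
    rw [mul_assoc (4 * A), ← Real.rpow_add two_pos, Real.rpow_one]
    have : (2 : ℝ) ^ (-((outLen γ n : ℝ) / 4)) ≤ (2 : ℝ) ^ (1 / 4 + -(9 / 40 * K)) :=
      Real.rpow_le_rpow_of_exponent_le one_le_two (by linarith)
    nlinarith
  have hlast : 1 / A * (2 : ℝ) ^ (-(4 / 5 * (n : ℝ))) ≤
      1 / A * (2 : ℝ) ^ (-(4 / 5 * K ^ (1 : ℝ))) := by
    rw [Real.rpow_one]
    gcongr
    norm_num
  rw [one_mul] at hζ
  linarith
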